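/- Let $S$ be a monoid. A right $S$-act is a set $X$ with a map $X\times S\to X$, $(x,s)\mapsto xs$, such that $x1=x$ and $x(st)=(xs)t$; left $S$-acts are defined dually. A subact of a right $S$-act $X$ is cyclic if it has the form $xS=\{xs : s\in S\}$ for some $x\in X$. The monoid $S$ satisfies condition $(A)$ if every right $S$-act satisfies the ascending chain condition for cyclic subacts. For a right $S$-act $A$ and a left $S$-act $C$, the tensor product $A\otimes_S C$ is the quotient of $A\times C$ by the equivalence relation generated by $(as,c)\sim(a,sc)$ for $a\in A$, $s\in S$, $c\in C$. An injective map of left $S$-acts $f:C\to D$ is a left pure $S$-monomorphism if for every right $S$-act $A$ the induced map $A\otimes_S C\to A\otimes_S D$, $a\otimes c\mapsto a\otimes f(c)$, is injective. A submonoid $S$ of a monoid $T$ is left pure if the inclusion $S\to T$ is a left pure $S$-monomorphism, where $S$ and $T$ are regarded as left $S$-acts by multiplication. **Proposition.** The class of monoids that satisfy condition $(A)$ is closed under the taking of left pure submonoids: if a monoid $T$ satisfies condition $(A)$ and $S$ is a left pure submonoid of $T$, then $S$ satisfies condition $(A)$. -/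

import Mathlib

/-!
Acts over monoids. A left act over a monoid `S` is a type `X` with `MulAction S X`, and a right act
is a type `X` with `MulAction Sᵐᵒᵖ X`; there the product `x s` is `MulOpposite.op s • x`.
-/

namespace MonoidAct

universe u v w z

section Tensor

/-- One elementary step `(a s, x) ↦ (a, s x)` in `A × X`, for a right act `A` and a left act `X`. -/
inductive TensorStep (S : Type u) [Monoid S] (A : Type v) [MulAction Sᵐᵒᵖ A]
    (X : Type w) [MulAction S X] : A × X → A × X → Prop
  | step (a : A) (s : S) (x : X) : TensorStep S A X (MulOpposite.op s • a, x) (a, s • x)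

/-- The tensor product `A ⊗_S X`: the quotient of `A × X` by the equivalence relation generated by
`(a s, x) ∼ (a, s x)`. -/
def Tensor (S : Type u) [Monoid S] (A : Type v) [MulAction Sᵐᵒᵖ A]
    (X : Type w) [MulAction S X] : Type (max v w) :=
  Quotient (Relation.EqvGen.setoid (TensorStep S A X))

/-- The element `a ⊗ x` of `A ⊗_S X`. -/
def Tensor.tmul (S : Type u) [Monoid S] {A : Type v} [MulAction Sᵐᵒᵖ A]
    {X : Type w} [MulAction S X] (a : A) (x : X) : Tensor S A X :=
  Quotient.mk (Relation.EqvGen.setoid (TensorStep S A X)) (a, x)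

theorem Tensor.tmul_smul {S : Type u} [Monoid S] {A : Type v} [MulAction Sᵐᵒᵖ A]
    {X : Type w} [MulAction S X] (a : A) (s : S) (x : X) :
    Tensor.tmul S (MulOpposite.op s • a) x = Tensor.tmul S a (s • x) :=
  Quotient.sound (Relation.EqvGen.rel _ _ (TensorStep.step a s x))

/-- The map `1 ⊗ f : A ⊗_S X → A ⊗_S Y`, `a ⊗ x ↦ a ⊗ f x`, induced by a map `f : X → Y` of
left acts. -/
def Tensor.mapRight {S : Type u} [Monoid S] (A : Type v) [MulAction Sᵐᵒᵖ A]
    {X : Type w} [MulAction S X] {Y : Type z} [MulAction S Y] (f : X →[S] Y) :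
    Tensor S A X → Tensor S A Y :=
  Quotient.lift (fun p : A × X => Tensor.tmul S p.1 (f p.2)) (by
    intro p q h
    change Relation.EqvGen (TensorStep S A X) p q at h
    induction h with
    | rel p q h =>
      cases h with
      | step a s x => simpa [map_smul] using Tensor.tmul_smul a s (f x)
    | refl p => rfl
    | symm p q _ ih => exact ih.symm
    | trans p q r _ _ ih₁ ih₂ => exact ih₁.trans ih₂)

end Tensor

section Pure

/-- A map `f : C → D` of left `S`-acts is a left pure monomorphism if it is injective and, for every
right `S`-act `A`, the induced map `A ⊗_S C → A ⊗_S D` is injective. -/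
structure IsLeftPureMono {S : Type u} [Monoid S] {C : Type v} [MulAction S C]
    {D : Type w} [MulAction S D] (f : C →[S] D) : Prop where
  injective : Function.Injective f
  tensor_injective : ∀ (A : Type u) [MulAction Sᵐᵒᵖ A],
    Function.Injective (Tensor.mapRight A f)

/-- The inclusion of a submonoid `S` of `T` into `T`, as a map of left `S`-acts. -/
def inclusionHom {T : Type u} [Monoid T] (S : Submonoid T) : S →[S] T where
  toFun := fun s => (s : T)
  map_smul' := fun _ _ => rfl

/-- A submonoid `S` of `T` is left pure if the inclusion `S → T` is a left pure monomorphism of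
left `S`-acts. -/
def IsLeftPureSubmonoid {T : Type u} [Monoid T] (S : Submonoid T) : Prop :=
  IsLeftPureMono (inclusionHom S)

end Pure

section ConditionA

/-- A subact `B` of a right `S`-act `X` is cyclic if `B = xS` for some `x`. -/
def IsCyclicSubact {S : Type u} [Monoid S] {X : Type v} [MulAction Sᵐᵒᵖ X]
    (B : SubMulAction Sᵐᵒᵖ X) : Prop :=
  ∃ x : X, (B : Set X) = {y | ∃ s : S, y = MulOpposite.op s • x}

/-- Condition (A) for a monoid `S`: every right `S`-act satisfies the ascending chain condition for
cyclic subacts. (Acts in the universe of `S` suffice, since the union of an ascending sequence of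
cyclic subacts is an act that is a quotient set of `ℕ × S`.) -/
def ConditionA (S : Type u) [Monoid S] : Prop :=
  ∀ (X : Type u) [MulAction Sᵐᵒᵖ X] (B : ℕ → SubMulAction Sᵐᵒᵖ X),
    (∀ n, IsCyclicSubact (B n)) → Monotone B → ∃ n, ∀ m, n ≤ m → B m = B n

end ConditionA

end MonoidAct

/-! For an ascending chain of cyclic subacts `x n`S of X, the subacts (`x n` ⊗ 1)T of X ⊗_S T also
ascend, so condition (A) for T makes them stabilise: `x m` ⊗ 1 = `x n` ⊗ t for large m ≥ n. Purity
must bring this back to `x m` ∈ U = `x n`S, which is `IsLeftPureSubmonoid.mem_of_tmul_eq`. There two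
copies of X are glued along U. The copies of `x n` agree, hence so do those of `x m` ⊗ 1 over T; by
purity they agree over S, so the two copies of `x m` are equal, which happens only inside U. -/

namespace MonoidAct

universe u v w z

section TensorLift

variable {S : Type u} [Monoid S] {A : Type v} [MulAction Sᵐᵒᵖ A] {X : Type w} [MulAction S X]

/-- The map out of `A ⊗_S X` induced by a balanced map on `A × X`. -/
def Tensor.lift {Z : Type z} (f : A → X → Z)
    (hf : ∀ (a : A) (s : S) (x : X), f (MulOpposite.op s • a) x = f a (s • x)) :
    Tensor S A X → Z :=
  Quotient.lift (fun p : A × X => f p.1 p.2) (by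
    intro p q h
    change Relation.EqvGen (TensorStep S A X) p q at h
    induction h with
    | rel p q h =>
      cases h with
      | step a s x => exact hf a s x
    | refl p => rfl
    | symm p q _ ih => exact ih.symm
    | trans p q r _ _ ih₁ ih₂ => exact ih₁.trans ih₂)

@[elab_as_elim]
theorem Tensor.induction_on {motive : Tensor S A X → Prop} (p : Tensor S A X)
    (tmul : ∀ a x, motive (Tensor.tmul S a x)) : motive p :=
  Quotient.inductionOn p fun q => tmul q.1 q.2

/-- An equality `a ⊗ x = b ⊗ y` is preserved by a map of right acts in the first factor. -/
theorem Tensor.tmul_eq_of_tmul_eq {A' : Type z} [MulAction Sᵐᵒᵖ A'] (g : A →[Sᵐᵒᵖ] A')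
    {a b : A} {x y : X} (h : Tensor.tmul S a x = Tensor.tmul S b y) :
    Tensor.tmul S (g a) x = Tensor.tmul S (g b) y :=
  congrArg (Tensor.lift (fun a x => Tensor.tmul S (g a) x) fun a s x => by
    rw [map_smul, Tensor.tmul_smul]) h

/-- The canonical isomorphism `A ⊗_S S → A` is injective on elements `a ⊗ 1`. -/
theorem Tensor.eq_of_tmul_one_eq {a b : A}
    (h : Tensor.tmul S a (1 : S) = Tensor.tmul S b (1 : S)) : a = b := by
  rw [← one_smul Sᵐᵒᵖ a, ← one_smul Sᵐᵒᵖ b]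
  exact congrArg (Tensor.lift (fun (a : A) (s : S) => MulOpposite.op s • a) fun a s t => by
    rw [smul_smul, ← MulOpposite.op_mul, smul_eq_mul]) h

end TensorLift

section BaseChange

variable {T : Type u} [Monoid T] (S : Submonoid T) {X : Type v} [MulAction Sᵐᵒᵖ X]

/-- The right `T`-act structure on `X ⊗_S T`. -/
instance : MulAction Tᵐᵒᵖ (Tensor S X T) where
  -- Balanced because right multiplication by T commutes with left multiplication by S.
  smul t := Tensor.lift (fun x t' => Tensor.tmul S x (t' * t.unop)) fun x s t' => by
    rw [Tensor.tmul_smul, smul_mul_assoc]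
  one_smul p := by
    refine Tensor.induction_on p fun x t' => ?_
    exact congrArg (Tensor.tmul S x) (mul_one t')
  mul_smul t₁ t₂ p := by
    refine Tensor.induction_on p fun x t' => ?_
    exact congrArg (Tensor.tmul S x) (mul_assoc t' t₂.unop t₁.unop).symm

theorem Tensor.op_smul_tmul (x : X) (t t' : T) :
    MulOpposite.op t • Tensor.tmul S x t' = Tensor.tmul S x (t' * t) :=
  rfl

/-- The cyclic subact `(x ⊗ 1) T` of `X ⊗_S T`. -/
def baseChangeCyclic (x : X) : SubMulAction Tᵐᵒᵖ (Tensor S X T) where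
  carrier := {p | ∃ t : T, p = Tensor.tmul S x t}
  smul_mem' := by
    rintro r _ ⟨t, rfl⟩
    exact ⟨t * r.unop, rfl⟩

theorem mem_baseChangeCyclic {x : X} {p : Tensor S X T} :
    p ∈ baseChangeCyclic S x ↔ ∃ t : T, p = Tensor.tmul S x t :=
  Iff.rfl

theorem isCyclicSubact_baseChangeCyclic (x : X) : IsCyclicSubact (baseChangeCyclic S x) := by
  refine ⟨Tensor.tmul S x 1, Set.ext fun p => ?_⟩
  simp only [SetLike.mem_coe, mem_baseChangeCyclic, Set.mem_ofPred_eq, Tensor.op_smul_tmul, one_mul]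

theorem baseChangeCyclic_smul_le (x : X) (s : S) :
    baseChangeCyclic S (MulOpposite.op s • x) ≤ baseChangeCyclic S x := by
  rintro _ ⟨t, rfl⟩
  exact ⟨s • t, Tensor.tmul_smul x s t⟩

end BaseChange

section Double

variable {M : Type u} [Monoid M] {X : Type v} [MulAction M X] (U : SubMulAction M X)

/-- Two points of `X × Bool` are identified if they agree or are the two copies of a point
of `U`. -/
def doubleSetoid : Setoid (X × Bool) where
  r p q := p.1 = q.1 ∧ (p.2 = q.2 ∨ p.1 ∈ U)
  iseqv :=
    { refl := fun _ => ⟨rfl, Or.inl rfl⟩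
      symm := by
        rintro ⟨x, b⟩ ⟨y, c⟩ ⟨h, h'⟩
        obtain rfl : x = y := h
        exact ⟨rfl, h'.imp_left Eq.symm⟩
      trans := by
        rintro ⟨x, b⟩ ⟨y, c⟩ ⟨z, d⟩ ⟨h, h'⟩ ⟨k, k'⟩
        obtain rfl : x = y := h
        obtain rfl : x = z := k
        refine ⟨rfl, ?_⟩
        rcases h' with h' | h'
        · exact k'.imp_left h'.trans
        · exact Or.inr h' }

/-- The amalgam of two copies of the act `X` over the subact `U`. -/
def Double : Type v :=
  Quotient (doubleSetoid U)

instance : MulAction M (Double U) where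
  smul m := Quotient.map (sa := doubleSetoid U) (sb := doubleSetoid U)
    (fun p => (m • p.1, p.2)) (by
      rintro ⟨x, b⟩ ⟨y, c⟩ ⟨h, h'⟩
      obtain rfl : x = y := h
      exact ⟨rfl, h'.imp_right (U.smul_mem m)⟩)
  one_smul p := by
    refine Quotient.inductionOn p fun q => ?_
    exact congrArg (fun x => Quotient.mk (doubleSetoid U) (x, q.2)) (one_smul M q.1)
  mul_smul m n p := by
    refine Quotient.inductionOn p fun q => ?_
    exact congrArg (fun x => Quotient.mk (doubleSetoid U) (x, q.2)) (mul_smul m n q.1)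

/-- The embedding of `X` as one of the two copies in the amalgam. -/
def Double.incl (b : Bool) : X →[M] Double U where
  toFun x := Quotient.mk (doubleSetoid U) (x, b)
  map_smul' _ _ := rfl

/-- Turns membership in U into an equation, which the injectivity in purity can test. -/
theorem Double.incl_true_eq_incl_false_iff {x : X} :
    Double.incl U true x = Double.incl U false x ↔ x ∈ U := by
  refine ⟨fun h => ?_, fun h => Quotient.sound ⟨rfl, Or.inr h⟩⟩
  exact (Quotient.exact h).2.resolve_left Bool.noConfusion

end Double

/-- If `S` is left pure in `T` and `x ⊗ 1 = y ⊗ t` in `X ⊗_S T` with `y` in a subact `U` of `X`,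
then `x` is in `U`. -/
theorem IsLeftPureSubmonoid.mem_of_tmul_eq {T : Type u} [Monoid T] {S : Submonoid T}
    (hS : IsLeftPureSubmonoid S) {X : Type u} [MulAction Sᵐᵒᵖ X] (U : SubMulAction Sᵐᵒᵖ X)
    {x y : X} (hy : y ∈ U) {t : T} (h : Tensor.tmul S x (1 : T) = Tensor.tmul S y t) : x ∈ U := by
  rw [← Double.incl_true_eq_incl_false_iff]
  apply Tensor.eq_of_tmul_one_eq (S := S)
  -- Purity is used only here, for the act `Double U`; the 1 of T is the image of the 1 of S.
  apply hS.tensor_injective (Double U)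
  change Tensor.tmul S (Double.incl U true x) (1 : T) = Tensor.tmul S (Double.incl U false x) (1 : T)
  rw [Tensor.tmul_eq_of_tmul_eq (Double.incl U true) h,
    Tensor.tmul_eq_of_tmul_eq (Double.incl U false) h,
    (Double.incl_true_eq_incl_false_iff U).2 hy]

end MonoidAct

theorem mainTheorem8 {T : Type*} [Monoid T] (S : Submonoid T)
    (hT : MonoidAct.ConditionA T) (hS : MonoidAct.IsLeftPureSubmonoid S) :
    MonoidAct.ConditionA S := by
  intro X _ B hB hmono
  choose x hx using hB
  have mem_iff (n : ℕ) (y : X) : y ∈ B n ↔ ∃ s : S, y = MulOpposite.op s • x n :=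
    Set.ext_iff.1 (hx n) y
  have x_mem (n : ℕ) : x n ∈ B n := (mem_iff n _).2 ⟨1, by simp⟩
  obtain ⟨n, hn⟩ := hT (MonoidAct.Tensor S X T) (fun n => MonoidAct.baseChangeCyclic S (x n))
    (fun n => MonoidAct.isCyclicSubact_baseChangeCyclic S (x n)) (by
      intro m n hmn
      obtain ⟨s, hs⟩ := (mem_iff n _).1 (hmono hmn (x_mem m))
      change MonoidAct.baseChangeCyclic S (x m) ≤ _
      rw [hs]
      exact MonoidAct.baseChangeCyclic_smul_le S (x n) s)
  refine ⟨n, fun m hm => le_antisymm (fun y hy => ?_) (hmono hm)⟩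
  have h : MonoidAct.Tensor.tmul S (x m) (1 : T) ∈ MonoidAct.baseChangeCyclic S (x n) := by
    rw [← hn m hm]
    exact ⟨1, rfl⟩
  obtain ⟨t, ht⟩ := h
  obtain ⟨s, rfl⟩ := (mem_iff m y).1 hy
  -- As `B n` is a subact, it is enough that it contains the generator `x m`.
  exact (B n).smul_mem _ (hS.mem_of_tmul_eq (B n) (x_mem n) ht)
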